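/- **Theorem 3.** Let $\mathcal X\subset\mathbb R^d$ be compact, let $k_0,\dots,k_N$ be kernels on $\mathbb R^d$ (continuous on $\mathcal X\times\mathcal X$) with reproducing kernel Hilbert spaces $\mathcal H_{k_j}$, let $f=g_0\in\mathcal H_{k_0}$ and $g_j\in\mathcal H_{k_j}$ with $\|g_j\|_{k_j}\le B_j$ for $0\le j\le N$, let $\lambda>0$, $\sigma\ge 0$ and $\delta\in(0,1)$. Evaluating at $x_t$ returns $y_{j,t}=g_j(x_t)+\nu_{j,t}$, $0\le j\le N$, where the $\nu_{j,t}$ are i.i.d. $\sigma$-sub-Gaussian and the noise at step $t$ is independent of the information available before step $t$. For the points $x_1,\dots,x_n$ put $K_{j,n}=(k_j(x_a,x_b))_{a,b\le n}$, $k_{j,n}(x)=(k_j(x_a,x))_{a\le n}$, $$\mu_{j,n}(x)=k_{j,n}(x)^\top(K_{j,n}+\lambda I)^{-1}(y_{j,1},\dots,y_{j,n})^\top,\qquad \sigma_{j,n}^2(x)=k_j(x,x)-k_{j,n}(x)^\top(K_{j,n}+\lambda I)^{-1}k_{j,n}(x),$$ $$\gamma_{j,n}=\max_{z_1,\dots,z_n\in\mathcal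 X}\tfrac12\log\det\bigl(I+\lambda^{-1}(k_j(z_a,z_b))_{a,b}\bigr),$$ $$l_{j,t}(x)=\mu_{j,t-1}(x)-\Bigl(B_j+\sigma\sqrt{2(\gamma_{j,t-1}+1+\ln((N+1)/\delta))}\Bigr)\sigma_{j,t-1}(x).$$ CONFIG does the following at each step $t=1,2,\dots$: if $\min_{x\in\mathcal X}l_{i,t}(x)>0$ for some $i\in\{1,\dots,N\}$, it declares infeasibility and stops; otherwise it evaluates at a point $x_t$ (chosen using only the information available before step $t$) that minimizes $l_{0,t}$ over $\{x\in\mathcal X: l_{i,t}(x)\le0,\ i=1,\dots,N\}$; if this set is empty although the test did not fire, the algorithm also stops and declares infeasibility. There is a constant $C>0$ that depends only on $\mathcal X$, the $k_j$, the $B_j$, $N$, $\sigma$, $\lambda$ and $\delta$ such that the following holds. If for some $i\in\{1,\dots,N\}$ $$\min_{x\in\mathcal X}g_i(x)=\epsilon>0\qquad\text{and}\qquad \gamma_{i,T}=o(\sqrt T)\ \ (T\to\infty),$$ then $$\overline T=\min\Bigl\{T\in\mathbb N_+ : \frac{\gamma_{i,T}}{\sqrt T}\le C\epsilon\Bigr\}$$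 exists, and with probability at least $1-\delta$ CONFIG declares infeasibility at some step $t\le\overline T$. On this same event, if the auxiliary feasible set is nonempty at every step up to which the test has not fired, then the declaration is made by the test $\min_{x\in\mathcal X}l_{i',t}(x)>0$ for some $i'\in\{1,\dots,N\}$ at a step $t\le\overline T$. -/

import Mathlib

open Matrix Filter Topology MeasureTheory ProbabilityTheory Asymptotics
open scoped NNReal ENNReal

noncomputable section

namespace CONFIG

/-- The ambient Euclidean space `ℝ^d`. -/
abbrev Pt (d : ℕ) : Type := EuclideanSpace ℝ (Fin d)

/-! ### Gaussian process surrogates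
`k` is a kernel, `lam` the noise variance of the surrogate model, `z` the list of the `n` points
sampled so far (repetitions are allowed) and `y` the list of the corresponding observations. -/

/-- The Gram matrix `(k (z a) (z b))_{a, b}`. -/
def gram {d n : ℕ} (k : Pt d → Pt d → ℝ) (z : Fin n → Pt d) : Matrix (Fin n) (Fin n) ℝ :=
  Matrix.of fun a b => k (z a) (z b)

/-- The vector `(k (z a) x)_a`. -/
def kvec {d n : ℕ} (k : Pt d → Pt d → ℝ) (z : Fin n → Pt d) (x : Pt d) : Fin n → ℝ :=
  fun a => k (z a) x

/-- Posterior mean `k_n(x)ᵀ (K_n + lam I)⁻¹ y`. -/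
def postMean {d n : ℕ} (k : Pt d → Pt d → ℝ) (lam : ℝ) (z : Fin n → Pt d) (y : Fin n → ℝ)
    (x : Pt d) : ℝ :=
  kvec k z x ⬝ᵥ ((gram k z + lam • (1 : Matrix (Fin n) (Fin n) ℝ))⁻¹ *ᵥ y)

/-- Posterior covariance `k(x, x') - k_n(x)ᵀ (K_n + lam I)⁻¹ k_n(x')`. -/
def postCov {d n : ℕ} (k : Pt d → Pt d → ℝ) (lam : ℝ) (z : Fin n → Pt d) (x x' : Pt d) : ℝ :=
  k x x' - kvec k z x ⬝ᵥ ((gram k z + lam • (1 : Matrix (Fin n) (Fin n) ℝ))⁻¹ *ᵥ kvec k z x')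

/-- Posterior standard deviation. -/
def postStd {d n : ℕ} (k : Pt d → Pt d → ℝ) (lam : ℝ) (z : Fin n → Pt d) (x : Pt d) : ℝ :=
  √(postCov k lam z x x)

/-- Information gain `(1/2) log det (I + lam⁻¹ K)` of a list of points. -/
def infoGain {d n : ℕ} (k : Pt d → Pt d → ℝ) (lam : ℝ) (z : Fin n → Pt d) : ℝ :=
  (1 / 2) * Real.log (1 + lam⁻¹ • gram k z : Matrix (Fin n) (Fin n) ℝ).det

/-- Maximum information gain over all lists of `n` points of `X`, repetitions allowed. For `X`
compact, nonempty, and `k` a kernel continuous on `X`, the supremum is a maximum. -/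
def maxInfoGain {d : ℕ} (k : Pt d → Pt d → ℝ) (lam : ℝ) (X : Set (Pt d)) (n : ℕ) : ℝ :=
  ⨆ z : Fin n → X, infoGain k lam (fun a => (z a : Pt d))

/-! ### The algorithm -/

/-- What the algorithm is given: the candidate set, the kernels and the norm bounds (index `0`
for the objective, index `i.succ` for the constraint `i : Fin N`), the sub-Gaussian parameter
`σ` of the observation noise, the surrogate noise variance and the confidence parameter. -/
structure Setup (d N : ℕ) where
  /-- candidate set -/
  X : Set (Pt d)
  /-- kernels -/
  k : Fin (N + 1) → Pt d → Pt d → ℝ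
  /-- bounds on the RKHS norms -/
  B : Fin (N + 1) → ℝ
  /-- sub-Gaussian parameter of the noise -/
  σ : ℝ≥0
  /-- noise variance of the surrogate model -/
  lam : ℝ
  /-- confidence parameter -/
  δ : ℝ

namespace Setup

variable {d N : ℕ}

/-- Maximum information gain of the `i`-th function. -/
def γ (S : Setup d N) (i : Fin (N + 1)) (n : ℕ) : ℝ :=
  maxInfoGain (S.k i) S.lam S.X n

/-- The confidence width multiplier used when `n` observations are available, that is at
step `n + 1`. -/
def sqrtBeta (S : Setup d N) (i : Fin (N + 1)) (n : ℕ) : ℝ :=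
  S.B i + S.σ * √(2 * (S.γ i n + 1 + Real.log (((N : ℝ) + 1) / S.δ)))

/-- The lower confidence bound for the `i`-th function given `n` observations. -/
def lcb (S : Setup d N) (i : Fin (N + 1)) {n : ℕ} (z : Fin n → Pt d)
    (y : Fin (N + 1) → Fin n → ℝ) (x : Pt d) : ℝ :=
  postMean (S.k i) S.lam z (y i) x - S.sqrtBeta i n * postStd (S.k i) S.lam z x

/-- The test of the algorithm: `min_{x ∈ X} lcb_i(x) > 0` for some constraint `i`. -/
def Test (S : Setup d N) {n : ℕ} (z : Fin n → Pt d) (y : Fin (N + 1) → Fin n → ℝ) : Prop :=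
  ∃ i : Fin N, ∃ m : ℝ, IsLeast (S.lcb i.succ z y '' S.X) m ∧ 0 < m

/-- The feasible set of the auxiliary problem
`min_{x ∈ X} lcb_0(x)` subject to `lcb_i(x) ≤ 0` for all constraints `i`. -/
def auxFeasible (S : Setup d N) {n : ℕ} (z : Fin n → Pt d) (y : Fin (N + 1) → Fin n → ℝ) :
    Set (Pt d) :=
  {x | x ∈ S.X ∧ ∀ i : Fin N, S.lcb i.succ z y x ≤ 0}

/-- Infeasibility is declared: the test fires or, more generally, the auxiliary problem has no
feasible point, so that no next query point exists. -/
def Declares (S : Setup d N) {n : ℕ} (z : Fin n → Pt d) (y : Fin (N + 1) → Fin n → ℝ) : Prop :=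
  S.Test z y ∨ S.auxFeasible z y = ∅

end Setup

/-- The list of the first `n` query points `x 0, …, x (n - 1)`. -/
def queries {d : ℕ} {Ω : Type*} (x : ℕ → Ω → Pt d) (n : ℕ) (ω : Ω) : Fin n → Pt d :=
  fun a => x a ω

/-- The noisy evaluations `h_j(x_a) + ν_{j,a}` of all functions at the first `n` query points. -/
def observations {d N : ℕ} {Ω : Type*} (h : Fin (N + 1) → Pt d → ℝ)
    (ν : Fin (N + 1) → ℕ → Ω → ℝ) (x : ℕ → Ω → Pt d) (n : ℕ) (ω : Ω) :
    Fin (N + 1) → Fin n → ℝ :=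
  fun j a => h j (x a ω) + ν j a ω

/-- The noise variables `ν j n` (`n` is the round, counted from `0`) are i.i.d. and
`σ`-sub-Gaussian; `𝓕 n` is the information available before round `n`, of which the noise of
round `n` is independent. -/
structure IsNoise {N : ℕ} {Ω : Type*} [mΩ : MeasurableSpace Ω] (σ : ℝ≥0) (μ : Measure Ω)
    (𝓕 : Filtration ℕ mΩ) (ν : Fin (N + 1) → ℕ → Ω → ℝ) : Prop where
  indep : iIndepFun (fun p : Fin (N + 1) × ℕ => ν p.1 p.2) μ
  identDistrib : ∀ i j n m, IdentDistrib (ν i n) (ν j m) μ μ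
  subgaussian : ∀ i n, HasSubgaussianMGF (ν i n) (σ ^ 2) μ
  adapted : ∀ i n, Measurable[𝓕 (n + 1)] (ν i n)
  indep_past : ∀ n, Indep (⨆ i, MeasurableSpace.comap (ν i n) inferInstance) (𝓕 n) μ

/-- `x` is the sequence of query points of a run of the algorithm on the functions `h`
(`h 0` the objective, `h i.succ` the constraints): `x n`, the query point of step `n + 1`, only
uses the information available before that step and, unless infeasibility has been declared, it
solves the auxiliary problem of that step. The values of `x` after a declaration are irrelevant
placeholders in `X`. -/
structure IsRun {d N : ℕ} {Ω : Type*} [mΩ : MeasurableSpace Ω] (S : Setup d N)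
    (h : Fin (N + 1) → Pt d → ℝ) (𝓕 : Filtration ℕ mΩ) (ν : Fin (N + 1) → ℕ → Ω → ℝ)
    (x : ℕ → Ω → Pt d) : Prop where
  measurable : ∀ n, Measurable[𝓕 n] (x n)
  mem : ∀ n ω, x n ω ∈ S.X
  optimal : ∀ n ω,
    (∀ m ≤ n, ¬ S.Declares (queries x m ω) (observations h ν x m ω)) →
      x n ω ∈ S.auxFeasible (queries x n ω) (observations h ν x n ω) ∧
      IsMinOn (S.lcb 0 (queries x n ω) (observations h ν x n ω))
        (S.auxFeasible (queries x n ω) (observations h ν x n ω)) (x n ω)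

end CONFIG

end

/-! Fix the constraint `g` whose minimum is `ε > 0`. While nothing is declared, each query solves
the auxiliary problem, so the lower bound of `g` there is at most `0`. The posterior mean is linear
in the data. Its noiseless part is off by at most `‖g‖` times the posterior deviation `s`
(`abs_postMean_sub_le`). Hence `ε ≤ (2B + σ√(2(γ + 1 + L'))) s + |m|`, where `m` is the posterior
mean of the noise alone at the next query. It remains to square, sum over `n < T` and bound `∑ s²`
and `∑ m²`.

The sum of variances is `O(γ_T)`, since the determinant of the regularized Gram matrix is a product
of one-step factors (`infoGain_eq_sum`, `sum_postCov_le`).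

For `∑ m²`, no confidence band valid at all points or all times is needed. With `w = s² / lam`, the
innovation identity (`inv_regGram_succ`, `sum_innovation_le`) gives `∑ (e - m)² / (1 + w) ≤ ∑ e²`,
that is, `∑ m² / (1 + w) ≤ ∑ (2me + we²) / (1 + w)`. As `m` and `w` are predictable, the exponential
moment of each term on the right can be bounded given the past, at the cost of a fraction of `m² /
(1 + w)` plus a multiple of `w / (1 + w)`. This makes the exponential of the sum of `compensated`
have mean at most one, and Markov's inequality at the single deterministic time `T` bounds `∑ m²` by
`O(log (1/δ) + γ_T)` (`sum_sq_postMean_le`).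

Together `T ε² ≤ D γ_T²` (`exists_sq_le_mul_maxInfoGain_sq`), which contradicts `γ_T ≤ C ε √T` when
`D C² < 1`. Only one noise sequence and one time enter, so the whole budget `δ` is available without
a union bound. -/

namespace CONFIG

/-! ### Kernel ridge regression in a feature space: innovations and information gain. -/

section FeatureMap

variable {d : ℕ} {E : Type*} [NormedAddCommGroup E] [InnerProductSpace ℝ E]
  {k : Pt d → Pt d → ℝ} {φ : Pt d → E} {lam : ℝ}

/-- Quadratic forms in the Gram matrix are squared norms in the feature space. -/
lemma dotProduct_gram_mulVec (hk : ∀ x y, k x y = inner ℝ (φ x) (φ y)) {n : ℕ}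
    (z : Fin n → Pt d) (v : Fin n → ℝ) :
    v ⬝ᵥ (gram k z *ᵥ v) = ‖∑ a, v a • φ (z a)‖ ^ 2 := by
  rw [← real_inner_self_eq_norm_sq, sum_inner]
  simp only [inner_sum, dotProduct, mulVec, gram, of_apply, hk, real_inner_smul_left,
    real_inner_smul_right, Finset.mul_sum]
  exact Finset.sum_congr rfl fun a _ => Finset.sum_congr rfl fun b _ => by ring

lemma gram_posSemidef (hk : ∀ x y, k x y = inner ℝ (φ x) (φ y)) {n : ℕ} (z : Fin n → Pt d) :
    (gram k z).PosSemidef := by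
  refine PosSemidef.of_dotProduct_mulVec_nonneg ?_ fun v => ?_
  · ext a b
    simp [gram, hk, real_inner_comm]
  · rw [star_trivial, dotProduct_gram_mulVec hk]
    positivity

lemma regGram_posDef (hk : ∀ x y, k x y = inner ℝ (φ x) (φ y)) (hlam : 0 < lam) {n : ℕ}
    (z : Fin n → Pt d) : (gram k z + lam • (1 : Matrix (Fin n) (Fin n) ℝ)).PosDef :=
  PosDef.posSemidef_add (gram_posSemidef hk z) (PosDef.one.smul hlam)

lemma regGram_mulVec_inv (hk : ∀ x y, k x y = inner ℝ (φ x) (φ y)) (hlam : 0 < lam) {n : ℕ}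
    (z : Fin n → Pt d) (v : Fin n → ℝ) :
    gram k z *ᵥ ((gram k z + lam • (1 : Matrix (Fin n) (Fin n) ℝ))⁻¹ *ᵥ v)
      + lam • ((gram k z + lam • (1 : Matrix (Fin n) (Fin n) ℝ))⁻¹ *ᵥ v) = v := by
  have h := (regGram_posDef hk hlam z).det_pos.ne'.isUnit
  have := congrArg (· *ᵥ v) (mul_nonsing_inv _ h)
  simpa [← mulVec_mulVec, add_mulVec, smul_mulVec] using this

lemma inv_regGram_symm (hk : ∀ x y, k x y = inner ℝ (φ x) (φ y)) (hlam : 0 < lam) {n : ℕ}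
    (z : Fin n → Pt d) (u v : Fin n → ℝ) :
    u ⬝ᵥ ((gram k z + lam • (1 : Matrix (Fin n) (Fin n) ℝ))⁻¹ *ᵥ v) =
      ((gram k z + lam • (1 : Matrix (Fin n) (Fin n) ℝ))⁻¹ *ᵥ u) ⬝ᵥ v := by
  have h : ((gram k z + lam • (1 : Matrix (Fin n) (Fin n) ℝ))⁻¹)ᵀ = _ :=
    ((regGram_posDef hk hlam z).isHermitian.inv)
  rw [dotProduct_mulVec, ← mulVec_transpose, h]

lemma inv_regGram_nonneg (hk : ∀ x y, k x y = inner ℝ (φ x) (φ y)) (hlam : 0 < lam) {n : ℕ}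
    (z : Fin n → Pt d) (v : Fin n → ℝ) :
    0 ≤ v ⬝ᵥ ((gram k z + lam • (1 : Matrix (Fin n) (Fin n) ℝ))⁻¹ *ᵥ v) := by
  simpa using (regGram_posDef hk hlam z).inv.posSemidef.dotProduct_mulVec_nonneg v

/-- With `v` the solution of `K v + lam v = e`, the gap between the two sides is `|K v|² + lam (v ⬝
K v)`, and `K` is positive semidefinite. -/
lemma lam_mul_inv_regGram_le (hk : ∀ x y, k x y = inner ℝ (φ x) (φ y)) (hlam : 0 < lam) {n : ℕ}
    (z : Fin n → Pt d) (e : Fin n → ℝ) :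
    lam * (e ⬝ᵥ ((gram k z + lam • (1 : Matrix (Fin n) (Fin n) ℝ))⁻¹ *ᵥ e)) ≤ e ⬝ᵥ e := by
  have h := regGram_mulVec_inv hk hlam z e
  set v := (gram k z + lam • (1 : Matrix (Fin n) (Fin n) ℝ))⁻¹ *ᵥ e
  have h1 : e ⬝ᵥ e = e ⬝ᵥ (gram k z *ᵥ v) + lam * (e ⬝ᵥ v) := by
    conv_lhs => rw [← h, dotProduct_add, dotProduct_smul, smul_eq_mul]
    rw [h]
  have h2 : e ⬝ᵥ (gram k z *ᵥ v) =
      (gram k z *ᵥ v) ⬝ᵥ (gram k z *ᵥ v) + lam * (v ⬝ᵥ (gram k z *ᵥ v)) := by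
    conv_lhs => rw [← h, add_dotProduct, smul_dotProduct, smul_eq_mul]
  have h3 := dotProduct_gram_mulVec hk z v
  have h4 : 0 ≤ (gram k z *ᵥ v) ⬝ᵥ (gram k z *ᵥ v) := by
    simpa using dotProduct_star_self_nonneg (gram k z *ᵥ v)
  have h5 : 0 ≤ lam * (v ⬝ᵥ (gram k z *ᵥ v)) := by rw [h3]; positivity
  linarith

/-- The posterior variance splits into the squared distance of `φ x` from the regression
combination of the features of the samples and the squared norm of the weights. -/
lemma postCov_self_eq (hk : ∀ x y, k x y = inner ℝ (φ x) (φ y)) (hlam : 0 < lam) {n : ℕ}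
    (z : Fin n → Pt d) (x : Pt d) (α : Fin n → ℝ)
    (hα : α = (gram k z + lam • (1 : Matrix (Fin n) (Fin n) ℝ))⁻¹ *ᵥ kvec k z x) :
    postCov k lam z x x = ‖φ x - ∑ a, α a • φ (z a)‖ ^ 2 + lam * (α ⬝ᵥ α) := by
  have h := regGram_mulVec_inv hk hlam z (kvec k z x)
  rw [← hα] at h
  have h1 : α ⬝ᵥ kvec k z x = ‖∑ a, α a • φ (z a)‖ ^ 2 + lam * (α ⬝ᵥ α) := by
    rw [← dotProduct_gram_mulVec hk]
    conv_lhs => rw [← h, dotProduct_add, dotProduct_smul, smul_eq_mul]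
  have h2 : inner ℝ (φ x) (∑ a, α a • φ (z a)) = α ⬝ᵥ kvec k z x := by
    simp [inner_sum, dotProduct, kvec, hk, real_inner_smul_right, real_inner_comm]
  rw [norm_sub_sq_real, h2, postCov, ← hα, dotProduct_comm (kvec k z x) α, hk x x,
    real_inner_self_eq_norm_sq]
  linarith

lemma postCov_self_nonneg (hk : ∀ x y, k x y = inner ℝ (φ x) (φ y)) (hlam : 0 < lam) {n : ℕ}
    (z : Fin n → Pt d) (x : Pt d) : 0 ≤ postCov k lam z x x := by
  rw [postCov_self_eq hk hlam z x _ rfl]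
  have := dotProduct_star_self_nonneg
    ((gram k z + lam • (1 : Matrix (Fin n) (Fin n) ℝ))⁻¹ *ᵥ kvec k z x)
  rw [star_trivial] at this
  positivity

lemma postCov_self_le (hk : ∀ x y, k x y = inner ℝ (φ x) (φ y)) (hlam : 0 < lam) {n : ℕ}
    (z : Fin n → Pt d) (x : Pt d) : postCov k lam z x x ≤ k x x :=
  sub_le_self _ (inv_regGram_nonneg hk hlam z _)

/-- The bias of the posterior mean on noiseless observations. -/
lemma abs_postMean_sub_le (hk : ∀ x y, k x y = inner ℝ (φ x) (φ y)) (hlam : 0 < lam) {n : ℕ}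
    (z : Fin n → Pt d) (x : Pt d) (g : E) :
    |postMean k lam z (fun a => inner ℝ (φ (z a)) g) x - inner ℝ (φ x) g|
      ≤ ‖g‖ * postStd k lam z x := by
  set α := (gram k z + lam • (1 : Matrix (Fin n) (Fin n) ℝ))⁻¹ *ᵥ kvec k z x with hα
  have h1 : postMean k lam z (fun a => inner ℝ (φ (z a)) g) x - inner ℝ (φ x) g
      = - inner ℝ (φ x - ∑ a, α a • φ (z a)) g := by
    rw [postMean, inv_regGram_symm hk hlam, ← hα, inner_sub_left, sum_inner]
    simp [dotProduct, real_inner_smul_left]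
  rw [h1, abs_neg]
  refine (abs_real_inner_le_norm _ _).trans ?_
  rw [mul_comm]
  refine mul_le_mul_of_nonneg_left (Real.le_sqrt_of_sq_le ?_) (norm_nonneg _)
  rw [postCov_self_eq hk hlam z x α hα]
  have := dotProduct_star_self_nonneg α
  rw [star_trivial] at this
  nlinarith

lemma postMean_add {n : ℕ} (z : Fin n → Pt d) (y e : Fin n → ℝ) (x : Pt d) :
    postMean k lam z (fun a => y a + e a) x = postMean k lam z y x + postMean k lam z e x := by
  have : (fun a => y a + e a) = y + e := rfl
  rw [this, postMean, mulVec_add, dotProduct_add]; rfl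

/-- Sequential (innovation) form of the quadratic form of the inverse regularized Gram matrix. -/
lemma inv_regGram_succ (hk : ∀ x y, k x y = inner ℝ (φ x) (φ y)) (hlam : 0 < lam)
    (z : ℕ → Pt d) (e : ℕ → ℝ) (n : ℕ) :
    (fun a : Fin (n + 1) => e a) ⬝ᵥ ((gram k (fun a : Fin (n + 1) => z a)
        + lam • (1 : Matrix (Fin (n + 1)) (Fin (n + 1)) ℝ))⁻¹ *ᵥ fun a => e a) =
      (fun a : Fin n => e a) ⬝ᵥ ((gram k (fun a : Fin n => z a)
        + lam • (1 : Matrix (Fin n) (Fin n) ℝ))⁻¹ *ᵥ fun a => e a)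
      + (e n - postMean k lam (fun a : Fin n => z a) (fun a => e a) (z n)) ^ 2
        / (lam + postCov k lam (fun a : Fin n => z a) (z n) (z n)) := by
  have hpc := postCov_self_nonneg hk hlam (fun a : Fin n => z a) (z n)
  set s := lam + postCov k lam (fun a : Fin n => z a) (z n) (z n) with hs
  have hs0 : s ≠ 0 := by positivity
  set p := (gram k (fun a : Fin n => z a) + lam • (1 : Matrix (Fin n) (Fin n) ℝ))⁻¹ *ᵥ
    fun a => e a with hp
  set q := (gram k (fun a : Fin n => z a) + lam • (1 : Matrix (Fin n) (Fin n) ℝ))⁻¹ *ᵥ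
    kvec k (fun a : Fin n => z a) (z n) with hq
  set m := postMean k lam (fun a : Fin n => z a) (fun a => e a) (z n) with hm
  have hm' : m = kvec k (fun a : Fin n => z a) (z n) ⬝ᵥ p := rfl
  have hm2 : m = (fun a : Fin n => e a) ⬝ᵥ q := by
    rw [hm', hp, inv_regGram_symm hk hlam, ← hq, dotProduct_comm]
  have hs' : s = lam + (k (z n) (z n) - kvec k (fun a : Fin n => z a) (z n) ⬝ᵥ q) := rfl
  set r := (e n - m) / s with hr
  have hp1 := regGram_mulVec_inv hk hlam (fun a : Fin n => z a) (fun a => e a)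
  have hq1 := regGram_mulVec_inv hk hlam (fun a : Fin n => z a)
    (kvec k (fun a : Fin n => z a) (z n))
  rw [← hp] at hp1
  rw [← hq] at hq1
  have hdet := (regGram_posDef hk hlam (fun a : Fin (n + 1) => z a)).det_pos.ne'.isUnit
  -- Block elimination: `s` is the Schur complement of the old block, so the last coordinate is the
  -- innovation over `s`, and the old solution `p` is corrected along `q`.
  have hsolve : (gram k (fun a : Fin (n + 1) => z a)
      + lam • (1 : Matrix (Fin (n + 1)) (Fin (n + 1)) ℝ)) *ᵥ
      (Fin.snoc (p - r • q) r : Fin (n + 1) → ℝ) = fun a : Fin (n + 1) => e a := by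
    ext a
    rw [add_mulVec, smul_mulVec, one_mulVec, Pi.add_apply, Pi.smul_apply, smul_eq_mul, mulVec,
      dotProduct, Fin.sum_univ_castSucc]
    simp only [gram, of_apply, Fin.snoc_castSucc, Fin.snoc_last, Fin.val_castSucc, Fin.val_last]
    refine Fin.lastCases ?_ (fun a => ?_) a
    · simp only [Fin.snoc_last, Fin.val_last]
      have h1 : ∑ b : Fin n, k (z n) (z b) * (p - r • q) b = m - r *
          (kvec k (fun a : Fin n => z a) (z n) ⬝ᵥ q) := by
        rw [hm', ← smul_eq_mul r, ← dotProduct_smul, ← dotProduct_sub, dotProduct]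
        refine Finset.sum_congr rfl fun b _ => ?_
        rw [kvec, hk, hk, real_inner_comm]
      have h2 : r * s = e n - m := by rw [hr]; field_simp
      rw [h1]
      rw [hs'] at h2
      linarith
    · simp only [Fin.snoc_castSucc, Fin.val_castSucc]
      have h1 : ∑ b : Fin n, k (z a) (z b) * (p - r • q) b =
          (gram k (fun a : Fin n => z a) *ᵥ p) a - r * (gram k (fun a : Fin n => z a) *ᵥ q) a := by
        exact congrFun ((mulVec_sub (gram k fun a : Fin n => z a) p (r • q)).trans
          (congrArg _ (mulVec_smul _ r q))) a
      have h2 := congrFun hp1 a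
      have h3 := congrFun hq1 a
      simp only [Pi.add_apply, Pi.smul_apply, smul_eq_mul, kvec, Pi.sub_apply] at h1 h2 h3 ⊢
      rw [h1]
      linear_combination h2 - r * h3
  have hinv : (gram k (fun a : Fin (n + 1) => z a)
      + lam • (1 : Matrix (Fin (n + 1)) (Fin (n + 1)) ℝ))⁻¹ *ᵥ (fun a : Fin (n + 1) => e a) =
      Fin.snoc (p - r • q) r := by
    rw [← hsolve, mulVec_mulVec, nonsing_inv_mul _ hdet, one_mulVec]
  rw [hinv, dotProduct, Fin.sum_univ_castSucc]
  simp only [Fin.snoc_castSucc, Fin.snoc_last, Fin.val_castSucc, Fin.val_last]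
  have h1 : ∑ b : Fin n, e b * (p - r • q) b = (fun a : Fin n => e a) ⬝ᵥ p - r * m := by
    rw [hm2, ← smul_eq_mul r, ← dotProduct_smul, ← dotProduct_sub]; rfl
  rw [h1, hr]
  field_simp
  ring

/-- Schur complement formula for the bordered matrix: the complement of the old block is the new
pivot. -/
lemma det_regGram_succ (hk : ∀ x y, k x y = inner ℝ (φ x) (φ y)) (hlam : 0 < lam)
    (z : ℕ → Pt d) (n : ℕ) :
    (gram k (fun a : Fin (n + 1) => z a)
        + lam • (1 : Matrix (Fin (n + 1)) (Fin (n + 1)) ℝ)).det =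
      (gram k (fun a : Fin n => z a) + lam • (1 : Matrix (Fin n) (Fin n) ℝ)).det
        * (lam + postCov k lam (fun a : Fin n => z a) (z n) (z n)) := by
  set M := gram k (fun a : Fin n => z a) + lam • (1 : Matrix (Fin n) (Fin n) ℝ) with hM
  have hdet := (regGram_posDef hk hlam (fun a : Fin n => z a)).det_pos.ne'.isUnit
  rw [← hM] at hdet
  let _ := invertibleOfIsUnitDet M hdet
  set κ := kvec k (fun a : Fin n => z a) (z n) with hκ
  have hb : (gram k (fun a : Fin (n + 1) => z a)
        + lam • (1 : Matrix (Fin (n + 1)) (Fin (n + 1)) ℝ)).submatrix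
        (finSumFinEquiv (m := n) (n := 1)) (finSumFinEquiv (m := n) (n := 1)) =
      fromBlocks M (replicateCol (Fin 1) κ) (replicateRow (Fin 1) κ)
        (of fun _ _ => k (z n) (z n) + lam) := by
    ext a b
    rcases a with a | a <;> rcases b with b | b
    · simp [hM, gram, one_apply, Fin.ext_iff]
    · have : Fin.castAdd 1 a ≠ Fin.natAdd n b := by
        intro h; have := congrArg Fin.val h; simp at this; omega
      have hb : b = 0 := Subsingleton.elim _ _
      subst hb
      simp [hκ, gram, kvec, one_apply, this]
    · have : Fin.natAdd n a ≠ Fin.castAdd 1 b := by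
        intro h; have := congrArg Fin.val h; simp at this; omega
      have ha : a = 0 := Subsingleton.elim _ _
      subst ha
      simp [hκ, gram, kvec, one_apply, this, hk, real_inner_comm]
    · have ha : a = 0 := Subsingleton.elim _ _
      have hb : b = 0 := Subsingleton.elim _ _
      subst ha hb
      simp [gram]
  rw [← det_submatrix_equiv_self (finSumFinEquiv (m := n) (n := 1)), hb, det_fromBlocks₁₁]
  congr 1
  rw [det_fin_one, Matrix.sub_apply, of_apply, postCov, ← hM, ← hκ, invOf_eq_nonsing_inv, Matrix.mul_assoc,
    ← replicateCol_mulVec, replicateRow_mul_replicateCol_apply]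
  ring

lemma infoGain_succ (hk : ∀ x y, k x y = inner ℝ (φ x) (φ y)) (hlam : 0 < lam)
    (z : ℕ → Pt d) (n : ℕ) :
    infoGain k lam (fun a : Fin (n + 1) => z a) = infoGain k lam (fun a : Fin n => z a)
      + 1 / 2 * Real.log (1 + postCov k lam (fun a : Fin n => z a) (z n) (z n) / lam) := by
  have key : ∀ n : ℕ, (1 + lam⁻¹ • gram k (fun a : Fin n => z a) : Matrix (Fin n) (Fin n) ℝ).det
      = lam⁻¹ ^ n * (gram k (fun a : Fin n => z a) + lam • (1 : Matrix (Fin n) (Fin n) ℝ)).det := by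
    intro n
    have : (1 + lam⁻¹ • gram k (fun a : Fin n => z a) : Matrix (Fin n) (Fin n) ℝ)
        = lam⁻¹ • (gram k (fun a : Fin n => z a) + lam • (1 : Matrix (Fin n) (Fin n) ℝ)) := by
      rw [smul_add, smul_smul, inv_mul_cancel₀ hlam.ne', one_smul, add_comm]
    rw [this, det_smul, Fintype.card_fin]
  have hpc := postCov_self_nonneg hk hlam (fun a : Fin n => z a) (z n)
  have hd := (regGram_posDef hk hlam (fun a : Fin n => z a)).det_pos
  rw [infoGain, infoGain, ← mul_add, key, key, det_regGram_succ hk hlam,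
    ← Real.log_mul (by positivity) (by positivity)]
  congr 2
  rw [pow_succ]
  field_simp

lemma infoGain_eq_sum (hk : ∀ x y, k x y = inner ℝ (φ x) (φ y)) (hlam : 0 < lam)
    (z : ℕ → Pt d) (n : ℕ) :
    infoGain k lam (fun a : Fin n => z a) = ∑ t ∈ Finset.range n,
      1 / 2 * Real.log (1 + postCov k lam (fun a : Fin t => z a) (z t) (z t) / lam) := by
  induction n with
  | zero => simp [infoGain]
  | succ n ih => rw [infoGain_succ hk hlam, ih, Finset.sum_range_succ]

/-- The energy of the normalized innovations is at most that of the observations. -/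
lemma sum_innovation_le (hk : ∀ x y, k x y = inner ℝ (φ x) (φ y)) (hlam : 0 < lam)
    (z : ℕ → Pt d) (e : ℕ → ℝ) (n : ℕ) :
    ∑ t ∈ Finset.range n, (e t - postMean k lam (fun a : Fin t => z a) (fun a => e a) (z t)) ^ 2
        / (1 + postCov k lam (fun a : Fin t => z a) (z t) (z t) / lam)
      ≤ ∑ t ∈ Finset.range n, e t ^ 2 := by
  have key : (fun a : Fin n => e a) ⬝ᵥ ((gram k (fun a : Fin n => z a)
        + lam • (1 : Matrix (Fin n) (Fin n) ℝ))⁻¹ *ᵥ fun a => e a) =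
      ∑ t ∈ Finset.range n, (e t - postMean k lam (fun a : Fin t => z a) (fun a => e a) (z t)) ^ 2
        / (lam + postCov k lam (fun a : Fin t => z a) (z t) (z t)) := by
    induction n with
    | zero => simp
    | succ n ih => rw [inv_regGram_succ hk hlam, ih, Finset.sum_range_succ]
  have h := lam_mul_inv_regGram_le hk hlam (fun a : Fin n => z a) (fun a => e a)
  have h2 : (fun a : Fin n => e a) ⬝ᵥ (fun a : Fin n => e a) = ∑ t ∈ Finset.range n, e t ^ 2 := by
    rw [dotProduct, Finset.sum_range]
    exact Finset.sum_congr rfl fun a _ => (sq _).symm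
  rw [key, h2, Finset.mul_sum] at h
  refine le_trans (le_of_eq ?_) h
  refine Finset.sum_congr rfl fun t _ => ?_
  have hpc := postCov_self_nonneg hk hlam (fun a : Fin t => z a) (z t)
  have h0 : lam + postCov k lam (fun a : Fin t => z a) (z t) (z t) ≠ 0 := by positivity
  field_simp

/-! ### Maximum information gain -/

lemma infoGain_le (hk : ∀ x y, k x y = inner ℝ (φ x) (φ y)) (hlam : 0 < lam) {X : Set (Pt d)}
    {M : ℝ} (hM : ∀ x ∈ X, k x x ≤ M) (z : ℕ → Pt d) (hz : ∀ n, z n ∈ X) (n : ℕ) :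
    infoGain k lam (fun a : Fin n => z a) ≤ n * (1 / 2 * Real.log (1 + M / lam)) := by
  rw [infoGain_eq_sum hk hlam, ← nsmul_eq_mul]
  conv_rhs => rw [← Finset.card_range n, ← Finset.sum_const]
  refine Finset.sum_le_sum fun t _ => ?_
  have hpc := postCov_self_nonneg hk hlam (fun a : Fin t => z a) (z t)
  have hpc' := (postCov_self_le hk hlam (fun a : Fin t => z a) (z t)).trans (hM _ (hz t))
  gcongr

/-- Lets the one-step formulas, which are stated for infinite sequences, be applied to the finite
lists in the supremum. -/
lemma exists_extension {X : Set (Pt d)} {n : ℕ} {x₀ : Pt d} (hx₀ : x₀ ∈ X) (z : Fin n → X) :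
    ∃ z' : ℕ → Pt d, (∀ t, z' t ∈ X) ∧ (fun a => (z a : Pt d)) = fun a : Fin n => z' a := by
  refine ⟨fun t => if h : t < n then z ⟨t, h⟩ else x₀, fun t => ?_, ?_⟩
  · dsimp only
    split_ifs
    exacts [Subtype.coe_prop _, hx₀]
  · ext1 a
    simp

lemma bddAbove_infoGain (hk : ∀ x y, k x y = inner ℝ (φ x) (φ y)) (hlam : 0 < lam)
    {X : Set (Pt d)} (hX : X.Nonempty) {M : ℝ} (hM : ∀ x ∈ X, k x x ≤ M) (n : ℕ) :
    BddAbove (Set.range fun z : Fin n → X => infoGain k lam (fun a => (z a : Pt d))) := by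
  obtain ⟨x₀, hx₀⟩ := hX
  refine ⟨n * (1 / 2 * Real.log (1 + M / lam)), ?_⟩
  rintro _ ⟨z, rfl⟩
  obtain ⟨z', hz', h⟩ := exists_extension hx₀ z
  dsimp only
  rw [h]
  exact infoGain_le hk hlam hM z' hz' n

lemma infoGain_le_maxInfoGain (hk : ∀ x y, k x y = inner ℝ (φ x) (φ y)) (hlam : 0 < lam)
    {X : Set (Pt d)} {M : ℝ} (hM : ∀ x ∈ X, k x x ≤ M) (z : ℕ → Pt d) (hz : ∀ n, z n ∈ X) (n : ℕ) :
    infoGain k lam (fun a : Fin n => z a) ≤ maxInfoGain k lam X n :=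
  le_ciSup (bddAbove_infoGain hk hlam ⟨_, hz 0⟩ hM n) (fun a : Fin n => (⟨z a, hz a⟩ : X))

lemma maxInfoGain_mono (hk : ∀ x y, k x y = inner ℝ (φ x) (φ y)) (hlam : 0 < lam)
    {X : Set (Pt d)} (hX : X.Nonempty) {M : ℝ} (hM : ∀ x ∈ X, k x x ≤ M) :
    Monotone (maxInfoGain k lam X) := by
  obtain ⟨x₀, hx₀⟩ := hX
  have : Nonempty X := ⟨⟨x₀, hx₀⟩⟩
  refine monotone_nat_of_le_succ fun n => ciSup_le fun z => ?_
  obtain ⟨z', hz', h⟩ := exists_extension hx₀ z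
  rw [h]
  refine le_trans ?_ (infoGain_le_maxInfoGain hk hlam hM z' hz' (n + 1))
  rw [infoGain_succ hk hlam]
  have hpc := postCov_self_nonneg hk hlam (fun a : Fin n => z' a) (z' n)
  have : 0 ≤ Real.log (1 + postCov k lam (fun a : Fin n => z' a) (z' n) (z' n) / lam) :=
    Real.log_nonneg (by have : 0 ≤ postCov k lam (fun a : Fin n => z' a) (z' n) (z' n) / lam := by
                          positivity
                        linarith)
  linarith

/-- Provides a positive lower bound for all later gains, against which additive constants are
absorbed. -/
lemma maxInfoGain_one_pos (hk : ∀ x y, k x y = inner ℝ (φ x) (φ y)) (hlam : 0 < lam)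
    {X : Set (Pt d)} {M : ℝ} (hM : ∀ x ∈ X, k x x ≤ M) {x₀ : Pt d} (hx₀ : x₀ ∈ X)
    (hpos : 0 < k x₀ x₀) : 0 < maxInfoGain k lam X 1 := by
  refine lt_of_lt_of_le ?_ (infoGain_le_maxInfoGain hk hlam hM (fun _ => x₀) (fun _ => hx₀) 1)
  rw [infoGain_eq_sum hk hlam (fun _ => x₀)]
  have : 0 < k x₀ x₀ / lam := by positivity
  simpa [postCov, dotProduct] using Real.log_pos (by linarith)

end FeatureMap

end CONFIG

namespace CONFIG

/-! ### Exponential moments of the noise terms and Markov's inequality. -/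

section Concentration

lemma lintegral_exp_mul_gaussianReal (a z : ℝ) (v : ℝ≥0) :
    ∫⁻ x, ENNReal.ofReal (Real.exp (x * z)) ∂(gaussianReal a v) =
      ENNReal.ofReal (Real.exp (a * z + v * z ^ 2 / 2)) := by
  have h := congrFun (mgf_id_gaussianReal (μ := a) (v := v)) z
  rw [mgf] at h
  rw [← h]
  simp only [id, mul_comm]
  rw [ofReal_integral_eq_lintegral_ofReal]
  · exact integrable_exp_mul_gaussianReal z
  · exact ae_of_all _ fun x => (Real.exp_pos _).le

/-- The exponential moment of a square under a Gaussian law. -/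
lemma lintegral_exp_sq_gaussianReal {a c : ℝ} {v : ℝ≥0} (hv : v * c < 1) :
    ∫⁻ x, ENNReal.ofReal (Real.exp (c * x ^ 2 / 2)) ∂(gaussianReal a v) =
      ENNReal.ofReal ((√(1 - v * c))⁻¹ * Real.exp (c * a ^ 2 / (2 * (1 - v * c)))) := by
  by_cases hv0 : v = 0
  · subst hv0
    simp [gaussianReal_zero_var, lintegral_dirac]
  have hr : 0 < 1 - v * c := by linarith
  have hvpos : (0 : ℝ) < v := by positivity
  set r := 1 - v * c with hrdef
  obtain ⟨R, hR⟩ : ∃ R : ℝ≥0, (R : ℝ) = r := ⟨⟨r, hr.le⟩, rfl⟩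
  have hs0 : v / R ≠ 0 := div_ne_zero hv0 fun h => hr.ne' (by rw [← hR, h, NNReal.coe_zero])
  rw [gaussianReal_of_var_ne_zero _ hv0, lintegral_withDensity_eq_lintegral_mul₀
    (measurable_gaussianPDF _ _).aemeasurable (by fun_prop)]
  have key : ∀ x, (gaussianPDF a v * fun x => ENNReal.ofReal (Real.exp (c * x ^ 2 / 2))) x =
      ENNReal.ofReal ((√r)⁻¹ * Real.exp (c * a ^ 2 / (2 * r))) *
        ENNReal.ofReal (gaussianPDFReal (a / r) (v / R) x) := by
    intro x
    rw [Pi.mul_apply, gaussianPDF, ← ENNReal.ofReal_mul (gaussianPDFReal_nonneg _ _ _),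
      ← ENNReal.ofReal_mul (by positivity)]
    congr 1
    rw [gaussianPDFReal, gaussianPDFReal, NNReal.coe_div, hR]
    have h1 : √(2 * Real.pi * (v / r)) = √(2 * Real.pi * v) / √r := by
      rw [← mul_div_assoc, Real.sqrt_div' _ hr.le]
    have hsr : 0 < √r := Real.sqrt_pos.2 hr
    have hsv : 0 < √(2 * Real.pi * v) := Real.sqrt_pos.2 (by positivity)
    have h2 : Real.exp (-(x - a) ^ 2 / (2 * v)) * Real.exp (c * x ^ 2 / 2) =
        Real.exp (c * a ^ 2 / (2 * r)) * Real.exp (-(x - a / r) ^ 2 / (2 * (v / r))) := by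
      rw [← Real.exp_add, ← Real.exp_add]
      congr 1
      -- Completing the square: the tilted density is proportional to the Gaussian density with mean
      -- `a / r` and variance `v / r`.
      have hc : c = (1 - r) / v := by rw [hrdef]; field_simp; ring
      rw [hc]
      field_simp
      ring
    rw [h1, mul_assoc, h2]
    field_simp
  rw [lintegral_congr key, lintegral_const_mul' _ _ ENNReal.ofReal_ne_top,
    lintegral_gaussianPDFReal_eq_one _ hs0, mul_one]

/-- The exponential moment of a quadratic polynomial in a sub-Gaussian variable. -/
lemma lintegral_exp_quadratic_le {Ω : Type*} [MeasurableSpace Ω] {μ : Measure Ω}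
    [IsProbabilityMeasure μ] {X : Ω → ℝ} (hXm : Measurable X) {c : ℝ≥0}
    (hX : HasSubgaussianMGF X c μ) (a : ℝ) {b : ℝ≥0} (hb : (b : ℝ) * c < 1) :
    ∫⁻ ω, ENNReal.ofReal (Real.exp (a * X ω + b * X ω ^ 2 / 2)) ∂μ ≤
      ENNReal.ofReal ((√(1 - b * c))⁻¹ * Real.exp (c * a ^ 2 / (2 * (1 - b * c)))) := by
  -- Linearize the square: the integrand is the mean of `exp (X Z)` for `Z` Gaussian with mean `a`
  -- and variance `b`. After swapping integrals, the sub-Gaussian bound applies for each fixed value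
  -- of `Z`.
  rw [← lintegral_exp_sq_gaussianReal hb]
  simp_rw [← lintegral_exp_mul_gaussianReal]
  rw [lintegral_lintegral_swap (by fun_prop)]
  refine lintegral_mono fun z => ?_
  rw [← ofReal_integral_eq_lintegral_ofReal (hX.integrable_exp_mul z)
    (ae_of_all _ fun x => (Real.exp_pos _).le)]
  exact ENNReal.ofReal_le_ofReal (hX.mgf_le z)

/-- The compensated exponent of the noise process, for predictable `m`, `w` and noise `e`. -/
noncomputable def compensated (c m w e : ℝ) : ℝ :=
  (8 * c)⁻¹ * ((2 * m * e + w * e ^ 2) / (1 + w) - m ^ 2 / (3 * (1 + w))) - w / (4 * (1 + w))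

/-- One step with the past frozen: the Gaussian prefactor `(1 - p)^(-1/2)` is paid for by `p = w /
(4(1 + w))`, and the remaining exponent by the `m²` term. -/
lemma lintegral_exp_compensated_le_one {Ω : Type*} [MeasurableSpace Ω] {μ : Measure Ω}
    [IsProbabilityMeasure μ] {X : Ω → ℝ} (hXm : Measurable X) {c : ℝ≥0} (hc : 0 < c)
    (hX : HasSubgaussianMGF X c μ) (m : ℝ) {w : ℝ} (hw : 0 ≤ w) :
    ∫⁻ ω, ENNReal.ofReal (Real.exp (compensated c m w (X ω))) ∂μ ≤ 1 := by
  have hc' : (0 : ℝ) < c := hc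
  have hw1 : 0 < 1 + w := by linarith
  let b : ℝ≥0 := ⟨w / (4 * c * (1 + w)), by positivity⟩
  have hbc : (b : ℝ) * c = w / (4 * (1 + w)) := by
    change w / (4 * c * (1 + w)) * c = _
    field_simp
  set p := w / (4 * (1 + w)) with hp
  have hp0 : 0 ≤ p := by positivity
  have hp1 : p ≤ 1 / 4 := by
    rw [hp, div_le_div_iff₀ (by positivity) (by norm_num)]
    linarith
  have h := lintegral_exp_quadratic_le hXm hX (m / (4 * c * (1 + w))) (b := b)
    (by rw [hbc]; linarith)
  set s := (8 * (c : ℝ))⁻¹ * (m ^ 2 / (3 * (1 + w))) + p with hs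
  have h1 : ∀ ω, ENNReal.ofReal (Real.exp (compensated c m w (X ω))) =
      ENNReal.ofReal (Real.exp (-s)) * ENNReal.ofReal (Real.exp (m / (4 * c * (1 + w)) * X ω
        + b * X ω ^ 2 / 2)) := by
    intro ω
    rw [← ENNReal.ofReal_mul (Real.exp_pos _).le, ← Real.exp_add]
    congr 2
    change _ = -s + (_ + w / (4 * c * (1 + w)) * X ω ^ 2 / 2)
    rw [compensated, hs, hp]
    field_simp
    ring
  rw [lintegral_congr h1, lintegral_const_mul' _ _ ENNReal.ofReal_ne_top]
  refine (mul_le_mul_right h _).trans ?_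
  rw [← ENNReal.ofReal_mul (Real.exp_pos _).le, hbc, ← ENNReal.ofReal_one]
  refine ENNReal.ofReal_le_ofReal ?_
  -- Since `p ≤ 1/4`, one has `1 / (1 - p) ≤ 1 + 2p ≤ exp (2p)`.
  have h2 : (√(1 - p))⁻¹ ≤ Real.exp p := by
    rw [inv_le_comm₀ (Real.sqrt_pos.2 (by linarith)) (Real.exp_pos _), ← Real.exp_neg]
    refine Real.le_sqrt_of_sq_le ?_
    rw [← Real.exp_nat_mul, ← neg_neg ((2 : ℕ) * -p), Real.exp_neg,
      inv_le_comm₀ (Real.exp_pos _) (by linarith)]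
    refine le_trans ?_ (Real.add_one_le_exp _)
    rw [inv_le_iff_one_le_mul₀ (by linarith)]
    push_cast
    nlinarith
  have h3 : c * (m / (4 * c * (1 + w))) ^ 2 / (2 * (1 - p)) ≤
      (8 * (c : ℝ))⁻¹ * (m ^ 2 / (3 * (1 + w))) := by
    have e1 : c * (m / (4 * c * (1 + w))) ^ 2 / (2 * (1 - p)) =
        m ^ 2 / (c * (1 + w)) * (1 / (32 * ((1 + w) * (1 - p)))) := by
      have : 1 - p ≠ 0 := by linarith
      field_simp
      ring
    have e2 : (8 * (c : ℝ))⁻¹ * (m ^ 2 / (3 * (1 + w))) = m ^ 2 / (c * (1 + w)) * (1 / 24) := by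
      field_simp
      ring
    rw [e1, e2]
    refine mul_le_mul_of_nonneg_left (one_div_le_one_div_of_le (by norm_num) ?_) (by positivity)
    nlinarith
  calc _ ≤ Real.exp (-s) * (Real.exp p * Real.exp ((8 * (c : ℝ))⁻¹ * (m ^ 2 / (3 * (1 + w))))) := by
        gcongr
    _ = 1 := by
        rw [← Real.exp_add, ← Real.exp_add, Real.exp_eq_one_iff, hs]
        ring

lemma measurable_compensated {Ω : Type*} {_ : MeasurableSpace Ω} (c : ℝ) {m w e : Ω → ℝ}
    (hm : Measurable m) (hw : Measurable w) (he : Measurable e) :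
    Measurable fun ω => compensated c (m ω) (w ω) (e ω) := by
  unfold compensated
  fun_prop

/-- The exponential of the accumulated compensated noise has expectation at most one. -/
lemma lintegral_exp_sum_compensated_le_one {Ω : Type*} [mΩ : MeasurableSpace Ω] {μ : Measure Ω}
    [IsProbabilityMeasure μ] {𝓕 : Filtration ℕ mΩ} {c : ℝ≥0} (hc : 0 < c) {e m w : ℕ → Ω → ℝ}
    (he : ∀ n, Measurable[𝓕 (n + 1)] (e n))
    (hind : ∀ n, Indep (MeasurableSpace.comap (e n) inferInstance) (𝓕 n) μ)
    (hsub : ∀ n, HasSubgaussianMGF (e n) c μ) (hm : ∀ n, Measurable[𝓕 n] (m n))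
    (hw : ∀ n, Measurable[𝓕 n] (w n)) (hw0 : ∀ n ω, 0 ≤ w n ω) (T : ℕ) :
    Measurable[𝓕 T] (fun ω => ∑ n ∈ Finset.range T, compensated c (m n ω) (w n ω) (e n ω)) ∧
    ∫⁻ ω, ENNReal.ofReal (Real.exp (∑ n ∈ Finset.range T,
      compensated c (m n ω) (w n ω) (e n ω))) ∂μ ≤ 1 := by
  induction T with
  | zero => simp
  | succ T ih =>
    obtain ⟨ihm, ih⟩ := ih
    have hmT : Measurable[𝓕 (T + 1)] (m T) := (hm T).mono (𝓕.mono T.le_succ) le_rfl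
    have hwT : Measurable[𝓕 (T + 1)] (w T) := (hw T).mono (𝓕.mono T.le_succ) le_rfl
    refine ⟨?_, ?_⟩
    · simp_rw [Finset.sum_range_succ]
      refine Measurable.add (ihm.mono (𝓕.mono T.le_succ) le_rfl) ?_
      exact measurable_compensated c hmT hwT (he T)
    set S : Ω → ℝ := fun ω => ∑ n ∈ Finset.range T, compensated c (m n ω) (w n ω) (e n ω) with hS
    set P : Ω → ℝ × ℝ × ℝ := fun ω => (S ω, m T ω, w T ω) with hP
    have hPm : Measurable[𝓕 T] P := ihm.prodMk ((hm T).prodMk (hw T))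
    have hPm' : Measurable P := hPm.mono (𝓕.le T) le_rfl
    have hem : Measurable (e T) := (he T).mono (𝓕.le _) le_rfl
    -- The past enters only through the triple `P`, so the joint law with the new noise is a product
    -- and the noise can be integrated first, with `P` fixed.
    have hindep : IndepFun P (e T) μ :=
      (indep_of_indep_of_le_right (hind T) hPm.comap_le).symm
    have hmap := (indepFun_iff_map_prod_eq_prod_map_map hPm'.aemeasurable hem.aemeasurable).1 hindep
    let F : (ℝ × ℝ × ℝ) × ℝ → ℝ≥0∞ := fun p =>
      ENNReal.ofReal (Real.exp p.1.1) *
        ENNReal.ofReal (Real.exp (compensated c p.1.2.1 p.1.2.2 p.2))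
    have hF : Measurable F := by
      have : Measurable fun p : (ℝ × ℝ × ℝ) × ℝ => compensated c p.1.2.1 p.1.2.2 p.2 :=
        measurable_compensated c measurable_fst.snd.fst measurable_fst.snd.snd measurable_snd
      exact (measurable_fst.fst.exp.ennreal_ofReal).mul this.exp.ennreal_ofReal
    have h1 : ∫⁻ ω, ENNReal.ofReal (Real.exp (∑ n ∈ Finset.range (T + 1),
        compensated c (m n ω) (w n ω) (e n ω))) ∂μ = ∫⁻ ω, F (P ω, e T ω) ∂μ := by
      refine lintegral_congr fun ω => ?_
      rw [Finset.sum_range_succ, Real.exp_add, ENNReal.ofReal_mul (Real.exp_pos _).le]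
    have : IsProbabilityMeasure (μ.map (e T)) := Measure.isProbabilityMeasure_map hem.aemeasurable
    rw [h1, ← lintegral_map hF (hPm'.prodMk hem), hmap, lintegral_prod _ hF.aemeasurable,
      lintegral_map hF.lintegral_prod_right' hPm']
    refine (lintegral_mono fun ω => ?_).trans ih
    simp only [F, hP]
    rw [lintegral_const_mul' _ _ ENNReal.ofReal_ne_top]
    refine mul_le_of_le_one_right' ?_
    rw [lintegral_map (f := fun y => ENNReal.ofReal (Real.exp (compensated c (m T ω) (w T ω) y)))
      (measurable_compensated c measurable_const measurable_const
        measurable_id).exp.ennreal_ofReal hem]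
    exact lintegral_exp_compensated_le_one hem hc (hsub T) _ (hw0 T ω)

/-- A high-probability upper bound for the accumulated compensated noise. -/
lemma measure_sum_compensated_lt {Ω : Type*} [mΩ : MeasurableSpace Ω] {μ : Measure Ω}
    [IsProbabilityMeasure μ] {𝓕 : Filtration ℕ mΩ} {c : ℝ≥0} (hc : 0 < c) {e m w : ℕ → Ω → ℝ}
    (he : ∀ n, Measurable[𝓕 (n + 1)] (e n))
    (hind : ∀ n, Indep (MeasurableSpace.comap (e n) inferInstance) (𝓕 n) μ)
    (hsub : ∀ n, HasSubgaussianMGF (e n) c μ) (hm : ∀ n, Measurable[𝓕 n] (m n))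
    (hw : ∀ n, Measurable[𝓕 n] (w n)) (hw0 : ∀ n ω, 0 ≤ w n ω) (T : ℕ) {δ : ℝ} (hδ : 0 < δ) :
    ∃ A : Set Ω, MeasurableSet A ∧ ENNReal.ofReal (1 - δ) ≤ μ A ∧ ∀ ω ∈ A,
      ∑ n ∈ Finset.range T, compensated c (m n ω) (w n ω) (e n ω) < Real.log (1 / δ) := by
  obtain ⟨hmeas, hle⟩ := lintegral_exp_sum_compensated_le_one hc he hind hsub hm hw hw0 T
  replace hmeas := hmeas.mono (𝓕.le T) le_rfl
  set S : Ω → ℝ := fun ω => ∑ n ∈ Finset.range T, compensated c (m n ω) (w n ω) (e n ω)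
  have hA : MeasurableSet {ω | S ω < Real.log (1 / δ)} := measurableSet_lt hmeas measurable_const
  refine ⟨_, hA, ?_, fun ω hω => hω⟩
  have hmk := mul_meas_ge_le_lintegral (μ := μ)
    (f := fun ω => ENNReal.ofReal (Real.exp (S ω))) (by fun_prop) (ENNReal.ofReal (1 / δ))
  have hsub : {ω | S ω < Real.log (1 / δ)}ᶜ ⊆
      {ω | ENNReal.ofReal (1 / δ) ≤ ENNReal.ofReal (Real.exp (S ω))} := by
    intro ω hω
    simp only [Set.mem_compl_iff, Set.mem_ofPred_eq, not_lt] at hω ⊢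
    refine ENNReal.ofReal_le_ofReal ?_
    rwa [← Real.log_le_iff_le_exp (by positivity)]
  have hcompl : μ {ω | S ω < Real.log (1 / δ)}ᶜ ≤ ENNReal.ofReal δ := by
    refine (measure_mono hsub).trans ?_
    have h := hmk.trans hle
    rw [one_div, ENNReal.ofReal_inv_of_pos hδ, mul_comm, ← div_eq_mul_inv] at h
    have := (ENNReal.div_le_iff (ENNReal.ofReal_pos.2 hδ).ne' ENNReal.ofReal_ne_top).1 h
    simpa [ENNReal.ofReal_inv_of_pos hδ] using this
  rw [ENNReal.ofReal_sub _ hδ.le, ENNReal.ofReal_one, tsub_le_iff_right]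
  rw [← measure_univ (μ := μ), ← measure_add_measure_compl hA]
  gcongr

end Concentration

/-! ### Measurability of the posterior quantities along random queries. -/

section Measurability

variable {d : ℕ} {Ω : Type*} {X : Set (Pt d)} {k : Pt d → Pt d → ℝ} {lam : ℝ}

/-- The kernel is continuous only on `X ×ˢ X`, so the composition passes through the subtype. -/
lemma measurable_kernel_comp {m : MeasurableSpace Ω}
    (hk : ContinuousOn (fun p : Pt d × Pt d => k p.1 p.2) (X ×ˢ X)) {f g : Ω → Pt d}
    (hf : Measurable f) (hg : Measurable g) (hfX : ∀ ω, f ω ∈ X) (hgX : ∀ ω, g ω ∈ X) :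
    Measurable fun ω => k (f ω) (g ω) := by
  have h1 := (continuousOn_iff_continuous_domRestrict.1 hk).measurable
  exact h1.comp ((hf.prodMk hg).subtype_mk (h := fun ω => Set.mk_mem_prod (hfX ω) (hgX ω)))

lemma measurable_inv_apply {m : MeasurableSpace Ω} {n : ℕ} {A : Ω → Matrix (Fin n) (Fin n) ℝ}
    (hA : ∀ a b, Measurable fun ω => A ω a b) (a b : Fin n) :
    Measurable fun ω => (A ω)⁻¹ a b := by
  have hdet : Measurable fun ω => (A ω).det := by
    simp_rw [det_apply']
    fun_prop
  have hadj : Measurable fun ω => (A ω).adjugate a b := by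
    simp_rw [adjugate_apply, det_apply']
    refine Finset.measurable_sum _ fun s _ => Measurable.const_mul
      (Finset.measurable_prod _ fun i _ => ?_) _
    by_cases h : s i = b
    · simp [updateRow_apply, h]
    · simpa [updateRow_apply, h] using hA _ _
  simp only [inv_def, Ring.inverse_eq_inv', Matrix.smul_apply, smul_eq_mul]
  exact hdet.inv.mul hadj

variable {m : MeasurableSpace Ω} {n : ℕ} {z : Ω → Fin n → Pt d} {x : Ω → Pt d}

lemma measurable_postMean
    (hk : ContinuousOn (fun p : Pt d × Pt d => k p.1 p.2) (X ×ˢ X))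
    (hz : ∀ a, Measurable fun ω => z ω a) (hzX : ∀ ω a, z ω a ∈ X)
    (hx : Measurable x) (hxX : ∀ ω, x ω ∈ X) {y : Ω → Fin n → ℝ}
    (hy : ∀ a, Measurable fun ω => y ω a) :
    Measurable fun ω => postMean k lam (z ω) (y ω) (x ω) := by
  simp only [postMean, dotProduct, mulVec, kvec]
  refine Finset.measurable_sum _ fun a _ => (measurable_kernel_comp hk (hz a) hx
    (fun ω => hzX ω a) hxX).mul (Finset.measurable_sum _ fun b _ => ?_)
  refine (measurable_inv_apply (fun a b => ?_) a b).mul (hy b)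
  simp only [gram, Matrix.add_apply, of_apply]
  exact (measurable_kernel_comp hk (hz a) (hz b) (fun ω => hzX ω a) fun ω => hzX ω b).add_const _

lemma measurable_postCov
    (hk : ContinuousOn (fun p : Pt d × Pt d => k p.1 p.2) (X ×ˢ X))
    (hz : ∀ a, Measurable fun ω => z ω a) (hzX : ∀ ω a, z ω a ∈ X)
    (hx : Measurable x) (hxX : ∀ ω, x ω ∈ X) :
    Measurable fun ω => postCov k lam (z ω) (x ω) (x ω) :=
  (measurable_kernel_comp hk hx hx hxX hxX).sub
    (measurable_postMean hk hz hzX hx hxX fun a =>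
      measurable_kernel_comp hk (hz a) hx (fun ω => hzX ω a) hxX)

end Measurability

end CONFIG

namespace CONFIG

/-! ### Summing the bounds along a run. -/

section Regret

lemma HasSubgaussianMGF.mono_param {Ω : Type*} [MeasurableSpace Ω] {μ : Measure Ω} {X : Ω → ℝ}
    {c c' : ℝ≥0} (h : HasSubgaussianMGF X c μ) (hcc' : c ≤ c') : HasSubgaussianMGF X c' μ where
  integrable_exp_mul := h.integrable_exp_mul
  mgf_le t := (h.mgf_le t).trans (by gcongr)

variable {d : ℕ} {E : Type*} [NormedAddCommGroup E] [InnerProductSpace ℝ E]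
  {k : Pt d → Pt d → ℝ} {φ : Pt d → E} {lam : ℝ}

/-- Termwise, `w ≤ (1 + w) log (1 + w)`, and `w` is at most `M / lam`. -/
lemma sum_postCov_le (hk : ∀ x y, k x y = inner ℝ (φ x) (φ y)) (hlam : 0 < lam)
    {X : Set (Pt d)} {M : ℝ} (hM : ∀ x ∈ X, k x x ≤ M) (z : ℕ → Pt d) (hz : ∀ n, z n ∈ X)
    (T : ℕ) :
    ∑ n ∈ Finset.range T, postCov k lam (fun a : Fin n => z a) (z n) (z n) / lam
      ≤ 2 * (1 + M / lam) * infoGain k lam (fun a : Fin T => z a) := by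
  rw [infoGain_eq_sum hk hlam, Finset.mul_sum]
  refine Finset.sum_le_sum fun n _ => ?_
  have hpc := postCov_self_nonneg hk hlam (fun a : Fin n => z a) (z n)
  have hpc' := (postCov_self_le hk hlam (fun a : Fin n => z a) (z n)).trans (hM _ (hz n))
  set w := postCov k lam (fun a : Fin n => z a) (z n) (z n) / lam
  have hw : 0 ≤ w := by positivity
  have hwM : w ≤ M / lam := div_le_div_of_nonneg_right hpc' hlam.le
  have h := Real.one_sub_inv_le_log_of_pos (x := 1 + w) (by positivity)
  have h2 : 0 ≤ Real.log (1 + w) := Real.log_nonneg (by linarith)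
  have h3 : w = (1 + w) * (1 - (1 + w)⁻¹) := by field_simp; ring
  calc w = (1 + w) * (1 - (1 + w)⁻¹) := h3
    _ ≤ (1 + w) * Real.log (1 + w) := by gcongr
    _ ≤ (1 + M / lam) * Real.log (1 + w) := by gcongr
    _ = _ := by ring

/-- A bound on the compensated noise bounds the posterior means of the noise at the next points. -/
lemma sum_sq_postMean_le (hk : ∀ x y, k x y = inner ℝ (φ x) (φ y)) (hlam : 0 < lam)
    {X : Set (Pt d)} {M : ℝ} (hM : ∀ x ∈ X, k x x ≤ M) (z : ℕ → Pt d) (hz : ∀ n, z n ∈ X)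
    (e : ℕ → ℝ) {c : ℝ} (hc : 0 < c) (T : ℕ) {L : ℝ}
    (hL : ∑ n ∈ Finset.range T, compensated c
      (postMean k lam (fun a : Fin n => z a) (fun a => e a) (z n))
      (postCov k lam (fun a : Fin n => z a) (z n) (z n) / lam) (e n) < L) :
    ∑ n ∈ Finset.range T, postMean k lam (fun a : Fin n => z a) (fun a => e a) (z n) ^ 2
      ≤ (1 + M / lam) * (12 * c * (L + infoGain k lam (fun a : Fin T => z a) / 2)) := by
  set w : ℕ → ℝ := fun n => postCov k lam (fun a : Fin n => z a) (z n) (z n) / lam with hwdef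
  set m : ℕ → ℝ := fun n => postMean k lam (fun a : Fin n => z a) (fun a => e a) (z n) with hmdef
  have hw : ∀ n, 0 ≤ w n := fun n =>
    div_nonneg (postCov_self_nonneg hk hlam (fun a : Fin n => z a) (z n)) hlam.le
  have hwM : ∀ n, w n ≤ M / lam := fun n => div_le_div_of_nonneg_right
    ((postCov_self_le hk hlam (fun a : Fin n => z a) (z n)).trans (hM _ (hz n))) hlam.le
  have hM0 : 0 ≤ M / lam := (hw 0).trans (hwM 0)
  have h1 : ∑ n ∈ Finset.range T, m n ^ 2 ≤
      (1 + M / lam) * ∑ n ∈ Finset.range T, m n ^ 2 / (1 + w n) := by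
    rw [Finset.mul_sum]
    refine Finset.sum_le_sum fun n _ => ?_
    have := hw n
    rw [mul_div_assoc', le_div_iff₀ (by positivity), mul_comm]
    have := hwM n
    gcongr
  refine h1.trans (mul_le_mul_of_nonneg_left ?_ (by positivity))
  have hinn := sum_innovation_le hk hlam z e T
  have hid : ∀ n, e n ^ 2 - (e n - m n) ^ 2 / (1 + w n) =
      (2 * m n * e n + w n * e n ^ 2) / (1 + w n) - m n ^ 2 / (1 + w n) := by
    intro n
    have := hw n
    field_simp
    ring
  have hquad : 0 ≤ ∑ n ∈ Finset.range T,
      ((2 * m n * e n + w n * e n ^ 2) / (1 + w n) - m n ^ 2 / (1 + w n)) := by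
    simp_rw [← hid]
    rw [Finset.sum_sub_distrib]
    exact sub_nonneg.2 hinn
  -- Only a third of `m² / (1 + w)` was subtracted in `compensated`. Completing it to the full term
  -- leaves `2/3 · 1/8 = 1/12` of it with a positive sign, which is what gets bounded.
  have hcomp : ∀ n, compensated c (m n) (w n) (e n) =
      (8 * c)⁻¹ * ((2 * m n * e n + w n * e n ^ 2) / (1 + w n) - m n ^ 2 / (1 + w n))
      + (12 * c)⁻¹ * (m n ^ 2 / (1 + w n)) - w n / (4 * (1 + w n)) := by
    intro n
    have := hw n
    rw [compensated]
    field_simp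
    ring
  have hlog : ∑ n ∈ Finset.range T, w n / (4 * (1 + w n)) ≤
      infoGain k lam (fun a : Fin T => z a) / 2 := by
    rw [infoGain_eq_sum hk hlam, Finset.sum_div]
    refine Finset.sum_le_sum fun n _ => ?_
    have hwn := hw n
    have h := Real.one_sub_inv_le_log_of_pos (x := 1 + w n) (by positivity)
    have h3 : w n / (4 * (1 + w n)) = 1 / 4 * (1 - (1 + w n)⁻¹) := by field_simp; ring
    change _ ≤ 1 / 2 * Real.log (1 + w n) / 2
    linarith
  have hL' : ∑ n ∈ Finset.range T, compensated c (m n) (w n) (e n) < L := hL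
  simp_rw [hcomp] at hL'
  rw [Finset.sum_sub_distrib, Finset.sum_add_distrib, ← Finset.mul_sum, ← Finset.mul_sum] at hL'
  have h8 : 0 ≤ (8 * c)⁻¹ * ∑ n ∈ Finset.range T,
      ((2 * m n * e n + w n * e n ^ 2) / (1 + w n) - m n ^ 2 / (1 + w n)) := by positivity
  have h9 : (12 * c)⁻¹ * ∑ n ∈ Finset.range T, m n ^ 2 / (1 + w n) ≤
      L + infoGain k lam (fun a : Fin T => z a) / 2 := by linarith
  rwa [inv_mul_le_iff₀ (by positivity)] at h9

/-- If none of the lower confidence bounds at the queries is positive, the minimum of the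
constraint is controlled by the maximum information gain. -/
lemma exists_sq_le_mul_maxInfoGain_sq (hk : ∀ x y, k x y = inner ℝ (φ x) (φ y)) (hlam : 0 < lam)
    {X : Set (Pt d)} {M : ℝ} (hM : ∀ x ∈ X, k x x ≤ M) (B σ c L L' : ℝ) (hc : 0 < c)
    (hσ : 0 ≤ σ) (hL : 0 ≤ L) (hL' : 0 ≤ L') :
    ∃ D : ℝ, 0 ≤ D ∧ ∀ (g : E) (z : ℕ → Pt d) (e : ℕ → ℝ) (ε : ℝ) (T : ℕ), ‖g‖ ≤ B →
      (∀ n, z n ∈ X) → 0 < ε → 1 ≤ T → (∀ n, ε ≤ inner ℝ (φ (z n)) g) →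
      (∀ n < T, postMean k lam (fun a : Fin n => z a)
          (fun a => inner ℝ (φ (z a)) g + e a) (z n)
        - (B + σ * √(2 * (maxInfoGain k lam X n + 1 + L')))
          * postStd k lam (fun a : Fin n => z a) (z n) ≤ 0) →
      ∑ n ∈ Finset.range T, compensated c
        (postMean k lam (fun a : Fin n => z a) (fun a => e a) (z n))
        (postCov k lam (fun a : Fin n => z a) (z n) (z n) / lam) (e n) < L →
      T * ε ^ 2 ≤ D * maxInfoGain k lam X T ^ 2 := by
  -- `D` must be fixed before `g` and `z` are known. If this fails, no admissible `g` and `z` exist: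
  -- a positive value of `g` at `z 0` forces `φ (z 0) ≠ 0`.
  by_cases hg1 : 0 < maxInfoGain k lam X 1 ∧ 0 ≤ M / lam
  swap
  · refine ⟨0, le_rfl, fun g z e ε T hg hz hε hT hge _ _ => (hg1 ⟨?_, ?_⟩).elim⟩
    · refine maxInfoGain_one_pos hk hlam hM (hz 0) ?_
      rw [hk, real_inner_self_eq_norm_sq]
      have : φ (z 0) ≠ 0 := by
        intro h
        have := hge 0
        rw [h, inner_zero_left] at this
        linarith
      positivity
    · refine div_nonneg (le_trans ?_ (hM _ (hz 0))) hlam.le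
      rw [hk, real_inner_self_eq_norm_sq]
      positivity
  obtain ⟨hg1, hW⟩ := hg1
  set g1 := maxInfoGain k lam X 1
  set W := M / lam with hWdef
  refine ⟨16 * lam * (1 + W) * (2 * B ^ 2 / g1 + σ ^ 2 * (1 + (1 + L') / g1))
    + 24 * c * (1 + W) * ((L / g1 + 1 / 2) / g1), by positivity,
    fun g z e ε T hg hz hε hT hge hlcb hcomp => ?_⟩
  have hmono := maxInfoGain_mono hk hlam ⟨_, hz 0⟩ hM
  set G := maxInfoGain k lam X T with hG
  have hg1G : g1 ≤ G := hmono hT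
  have hIG : infoGain k lam (fun a : Fin T => z a) ≤ G := infoGain_le_maxInfoGain hk hlam hM z hz T
  have hG0 : 0 < G := hg1.trans_le hg1G
  set m : ℕ → ℝ := fun n => postMean k lam (fun a : Fin n => z a) (fun a => e a) (z n) with hmdef
  set w : ℕ → ℝ := fun n => postCov k lam (fun a : Fin n => z a) (z n) (z n) / lam with hwdef
  set a := 16 * B ^ 2 + 8 * σ ^ 2 * (G + 1 + L') with ha
  have ha0 : 0 ≤ a := by positivity
  -- `(u + v)² ≤ 2u² + 2v²` is used twice: to split off `m`, then inside `(2B + σ r)² ≤ a / 2`.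
  have hstep : ∀ n ∈ Finset.range T, ε ^ 2 ≤ a * lam * w n + 2 * m n ^ 2 := by
    intro n hn
    have hn := Finset.mem_range.1 hn
    have h1 := hlcb n hn
    rw [postMean_add] at h1
    have h2 := (abs_le.1 (abs_postMean_sub_le hk hlam (fun a : Fin n => z a) (z n) g)).1
    have hpc := postCov_self_nonneg hk hlam (fun a : Fin n => z a) (z n)
    set s := postStd k lam (fun a : Fin n => z a) (z n) with hs
    have hs0 : 0 ≤ s := Real.sqrt_nonneg _
    have hs2 : s ^ 2 = lam * w n := by
      rw [hs, postStd, Real.sq_sqrt hpc, hwdef]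
      field_simp
    set r := √(2 * (G + 1 + L')) with hr
    have hr2 : r ^ 2 = 2 * (G + 1 + L') := Real.sq_sqrt (by positivity)
    have hrn : √(2 * (maxInfoGain k lam X n + 1 + L')) ≤ r := by
      have : maxInfoGain k lam X n ≤ G := hmono hn.le
      exact Real.sqrt_le_sqrt (by linarith)
    have h3 : (B + σ * √(2 * (maxInfoGain k lam X n + 1 + L'))) * s ≤ (B + σ * r) * s := by gcongr
    have h4 : ‖g‖ * s ≤ B * s := by gcongr
    have h5 : ε ≤ (2 * B + σ * r) * s + |m n| := by
      have := hge n
      have h6 : -m n ≤ |m n| := neg_le_abs _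
      have h7 : m n = postMean k lam (fun a : Fin n => z a) (fun a => e a) (z n) := rfl
      linarith
    have h6 : ε ^ 2 ≤ ((2 * B + σ * r) * s + |m n|) ^ 2 := by gcongr
    have h7 : (2 * B + σ * r) ^ 2 ≤ a / 2 := by
      have : a / 2 = 2 * (2 * B) ^ 2 + 2 * (σ ^ 2 * r ^ 2) := by rw [ha, hr2]; ring
      rw [this]
      nlinarith [sq_nonneg (2 * B - σ * r)]
    have h8 : ((2 * B + σ * r) * s) ^ 2 ≤ a / 2 * (lam * w n) := by
      rw [mul_pow, hs2]
      refine mul_le_mul_of_nonneg_right h7 ?_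
      rw [← hs2]; positivity
    nlinarith [sq_nonneg ((2 * B + σ * r) * s - |m n|), sq_abs (m n)]
  have hsum := Finset.sum_le_sum hstep
  rw [Finset.sum_const, Finset.card_range, nsmul_eq_mul, Finset.sum_add_distrib, ← Finset.mul_sum,
    ← Finset.mul_sum] at hsum
  have hw := sum_postCov_le hk hlam hM z hz T
  have hm := sum_sq_postMean_le hk hlam hM z hz e hc T hcomp
  rw [← hWdef] at hw hm
  have hw' : ∑ n ∈ Finset.range T, w n ≤ 2 * (1 + W) * G := hw.trans (by gcongr)
  have hm' : ∑ n ∈ Finset.range T, m n ^ 2 ≤ (1 + W) * (12 * c * (L + G / 2)) :=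
    hm.trans (by gcongr)
  -- Multiplying lower-order terms by `G / g1` makes the final bound homogeneous of degree two in
  -- `G`.
  have hone : 1 ≤ G / g1 := (one_le_div hg1).2 hg1G
  have ha' : a ≤ G * (16 * B ^ 2 / g1 + 8 * σ ^ 2 * (1 + (1 + L') / g1)) := by
    have h1 : 16 * B ^ 2 ≤ 16 * B ^ 2 * (G / g1) := le_mul_of_one_le_right (by positivity) hone
    have h2 : 1 + L' ≤ (1 + L') * (G / g1) := le_mul_of_one_le_right (by positivity) hone
    have h3 : 8 * σ ^ 2 * (G + 1 + L') ≤ 8 * σ ^ 2 * (G + (1 + L') * (G / g1)) := by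
      refine mul_le_mul_of_nonneg_left ?_ (by positivity)
      linarith
    calc a ≤ 16 * B ^ 2 * (G / g1) + 8 * σ ^ 2 * (G + (1 + L') * (G / g1)) := add_le_add h1 h3
      _ = _ := by field_simp
  have hb' : L + G / 2 ≤ G ^ 2 * ((L / g1 + 1 / 2) / g1) := by
    have h1 : L ≤ L * (G / g1) := le_mul_of_one_le_right hL hone
    have h2 : L * (G / g1) + G / 2 ≤ (L * (G / g1) + G / 2) * (G / g1) :=
      le_mul_of_one_le_right (by positivity) hone
    calc L + G / 2 ≤ (L * (G / g1) + G / 2) * (G / g1) := by linarith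
      _ = _ := by field_simp
  calc (T : ℝ) * ε ^ 2 ≤ a * lam * (2 * (1 + W) * G) + 2 * ((1 + W) * (12 * c * (L + G / 2))) := by
        refine hsum.trans ?_
        gcongr
    _ ≤ G * (16 * B ^ 2 / g1 + 8 * σ ^ 2 * (1 + (1 + L') / g1)) * lam * (2 * (1 + W) * G)
        + 2 * ((1 + W) * (12 * c * (G ^ 2 * ((L / g1 + 1 / 2) / g1)))) := by gcongr
    _ = _ := by ring

end Regret

end CONFIG

/-! ### The main theorem. -/

theorem theorem3 {d N : ℕ} (S : CONFIG.Setup d N)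
    (hX : IsCompact S.X)
    (hkcont : ∀ j, ContinuousOn (fun p : CONFIG.Pt d × CONFIG.Pt d => S.k j p.1 p.2) (S.X ×ˢ S.X))
    (hlam : 0 < S.lam) (hδ : 0 < S.δ) (hδ' : S.δ < 1)
    -- `H j` is the reproducing kernel Hilbert space of the kernel `S.k j`
    (H : Fin (N + 1) → Type*) [∀ j, NormedAddCommGroup (H j)] [∀ j, InnerProductSpace ℝ (H j)]
    [∀ j, CompleteSpace (H j)] [∀ j, RKHS ℝ (H j) (CONFIG.Pt d) ℝ]
    (hH : ∀ j x x', RKHS.kernel (H j) x x' 1 = S.k j x x') :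
    -- the constant hidden in `O(ε)`
    ∃ C : ℝ, 0 < C ∧
      ∀ (Ω : Type*) [mΩ : MeasurableSpace Ω] (μ : Measure Ω) [IsProbabilityMeasure μ]
        (𝓕 : Filtration ℕ mΩ) (h : ∀ j, H j) (ν : Fin (N + 1) → ℕ → Ω → ℝ)
        (x : ℕ → Ω → CONFIG.Pt d) (i : Fin N) (ε : ℝ),
        (∀ j, ‖h j‖ ≤ S.B j) →
        CONFIG.IsNoise S.σ μ 𝓕 ν →
        CONFIG.IsRun S (fun j => ⇑(h j)) 𝓕 ν x →
        IsLeast (⇑(h i.succ) '' S.X) ε → 0 < ε →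
        (fun T : ℕ => S.γ i.succ T) =o[atTop] (fun T : ℕ => √(T : ℝ)) →
        ∃ Tbar : ℕ, IsLeast {T : ℕ | 1 ≤ T ∧ S.γ i.succ T / √(T : ℝ) ≤ C * ε} Tbar ∧
          ∃ A : Set Ω, MeasurableSet A ∧ ENNReal.ofReal (1 - S.δ) ≤ μ A ∧
            ∀ ω ∈ A,
              -- infeasibility is declared at a step `n + 1 ≤ Tbar`
              (∃ n < Tbar, S.Declares (CONFIG.queries x n ω)
                (CONFIG.observations (fun j => ⇑(h j)) ν x n ω)) ∧
              -- and by the test itself, if the auxiliary problem is feasible when the test passes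
              ((∀ n, (∀ m ≤ n, ¬ S.Test (CONFIG.queries x m ω)
                    (CONFIG.observations (fun j => ⇑(h j)) ν x m ω)) →
                  (S.auxFeasible (CONFIG.queries x n ω)
                    (CONFIG.observations (fun j => ⇑(h j)) ν x n ω)).Nonempty) →
                ∃ n < Tbar, S.Test (CONFIG.queries x n ω)
                  (CONFIG.observations (fun j => ⇑(h j)) ν x n ω)) := by
  have hk : ∀ j x y, S.k j x y =
      inner ℝ (RKHS.kerFun (H j) x (1 : ℝ)) (RKHS.kerFun (H j) y (1 : ℝ)) := by
    intro j x y
    rw [real_inner_comm, ← RKHS.kernel_inner, hH]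
    simp
  have heval : ∀ j x (g : H j), inner ℝ (RKHS.kerFun (H j) x (1 : ℝ)) g = g x := by
    intro j x g
    rw [RKHS.kerFun_inner]
    simp
  have hM : ∀ j, ∃ M, ∀ x ∈ S.X, S.k j x x ≤ M := by
    intro j
    have hcont : ContinuousOn (fun x => S.k j x x) S.X :=
      (hkcont j).comp (continuousOn_id.prodMk continuousOn_id) fun x hx => ⟨hx, hx⟩
    obtain ⟨M, hM⟩ := hX.exists_bound_of_continuousOn hcont
    exact ⟨M, fun x hx => (le_abs_self _).trans (hM x hx)⟩
  choose M hM using hM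
  have hL : 0 ≤ Real.log (1 / S.δ) := Real.log_nonneg ((one_le_div hδ).2 hδ'.le)
  have hL' : 0 ≤ Real.log (((N : ℝ) + 1) / S.δ) :=
    Real.log_nonneg ((one_le_div hδ).2 (by linarith [N.cast_nonneg (α := ℝ)]))
  -- The variance proxy is enlarged to `σ² + 1` so that it is positive even if `σ = 0`. The
  -- placeholders are `log (1/δ)`, from Markov's inequality, and `log ((N + 1)/δ)`, from the
  -- algorithm's width.
  choose D hD0 hD using fun j => CONFIG.exists_sq_le_mul_maxInfoGain_sq (hk j) hlam (hM j)
    (S.B j) S.σ (S.σ ^ 2 + 1) _ _ (by positivity) S.σ.coe_nonneg hL hL'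
  have hDsum : 0 ≤ ∑ j, D j := Finset.sum_nonneg fun j _ => hD0 j
  -- Summing over `j` makes the constant independent of which constraint is infeasible; the `+ 1`
  -- gives the strict inequality `(∑ j, D j) * C ^ 2 < 1`.
  refine ⟨1 / (∑ j, D j + 1), by positivity, ?_⟩
  intro Ω mΩ μ _ 𝓕 h ν x i ε hB hν hx hε hε0 hγ
  set C := 1 / (∑ j, D j + 1) with hC
  have hC0 : 0 < C := by positivity
  have hex : ∃ T : ℕ, 1 ≤ T ∧ S.γ i.succ T / √(T : ℝ) ≤ C * ε := by
    have := (hγ.tendsto_div_nhds_zero.eventually_le_const (mul_pos hC0 hε0)).and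
      (eventually_ge_atTop 1)
    obtain ⟨T, h1, h2⟩ := this.exists
    exact ⟨T, h2, h1⟩
  classical
  refine ⟨Nat.find hex, ⟨Nat.find_spec hex, fun T hT => Nat.find_min' hex hT⟩, ?_⟩
  obtain ⟨hT1, hTγ⟩ := Nat.find_spec hex
  set T := Nat.find hex
  have hxm : ∀ n (a : Fin n), Measurable[𝓕 n] (x a) := fun n a =>
    (hx.measurable a).mono (𝓕.mono a.2.le) le_rfl
  obtain ⟨A, hA, hμA, hsum⟩ := CONFIG.measure_sum_compensated_lt (μ := μ) (𝓕 := 𝓕)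
    (c := S.σ ^ 2 + 1) (e := ν i.succ)
    (m := fun n ω => CONFIG.postMean (S.k i.succ) S.lam (CONFIG.queries x n ω)
      (fun a => ν i.succ a ω) (x n ω))
    (w := fun n ω => CONFIG.postCov (S.k i.succ) S.lam (CONFIG.queries x n ω) (x n ω) (x n ω)
      / S.lam) (by positivity) (fun n => hν.adapted i.succ n)
    (fun n => indep_of_indep_of_le_left (hν.indep_past n)
      (le_iSup (fun j => MeasurableSpace.comap (ν j n) inferInstance) i.succ))
    (fun n => CONFIG.HasSubgaussianMGF.mono_param (hν.subgaussian i.succ n)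
      (le_add_of_nonneg_right zero_le_one))
    (fun n => CONFIG.measurable_postMean (hkcont i.succ) (hxm n) (fun ω a => hx.mem a ω)
      (hx.measurable n) (hx.mem n)
      fun a => (hν.adapted i.succ a).mono (𝓕.mono a.2) le_rfl)
    (fun n => (CONFIG.measurable_postCov (hkcont i.succ) (hxm n) (fun ω a => hx.mem a ω)
      (hx.measurable n) (hx.mem n)).div_const _)
    (fun n ω => div_nonneg (CONFIG.postCov_self_nonneg (hk i.succ) hlam _ _) hlam.le) T hδ
  refine ⟨A, hA, hμA, fun ω hω => ?_⟩
  have hdecl : ∃ n < T, S.Declares (CONFIG.queries x n ω)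
      (CONFIG.observations (fun j => ⇑(h j)) ν x n ω) := by
    by_contra! hcon
    have hle : T * ε ^ 2 ≤ D i.succ * S.γ i.succ T ^ 2 := by
      refine hD i.succ (h i.succ) (fun n => x n ω) (fun n => ν i.succ n ω) ε T
        (hB _) (fun n => hx.mem n ω) hε0 hT1 (fun n => ?_)
        (fun n hn => ?_) (by
          have := hsum ω hω
          push_cast at this
          exact this)
      · rw [heval]
        exact hε.2 ⟨_, hx.mem n ω, rfl⟩
      -- Only feasibility of the query for the auxiliary problem is used here, not its optimality.
      · have := (hx.optimal n ω fun m hm => hcon m (hm.trans_lt hn)).1.2 i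
        simp_rw [heval]
        exact this
    have hTpos : (0 : ℝ) < T := by exact_mod_cast hT1
    have hγ0 : 0 ≤ S.γ i.succ T := by
      refine (?_ : (0 : ℝ) ≤ S.γ i.succ 0).trans
        (CONFIG.maxInfoGain_mono (hk i.succ) hlam ⟨_, hx.mem 0 ω⟩ (hM i.succ) (Nat.zero_le _))
      have := CONFIG.infoGain_le_maxInfoGain (hk i.succ) hlam (hM i.succ) (fun n => x n ω)
        (fun n => hx.mem n ω) 0
      simpa [CONFIG.infoGain, CONFIG.Setup.γ] using this
    have h1 : S.γ i.succ T ≤ C * ε * √T := (div_le_iff₀ (Real.sqrt_pos.2 hTpos)).1 hTγ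
    have h2 : S.γ i.succ T ^ 2 ≤ C ^ 2 * (T * ε ^ 2) := by
      calc S.γ i.succ T ^ 2 ≤ (C * ε * √T) ^ 2 := by gcongr
        _ = C ^ 2 * (T * ε ^ 2) := by rw [mul_pow, Real.sq_sqrt hTpos.le]; ring
    have hDle : D i.succ ≤ ∑ j, D j :=
      Finset.single_le_sum (fun j _ => hD0 j) (Finset.mem_univ i.succ)
    have h3 : T * ε ^ 2 ≤ (∑ j, D j) * (C ^ 2 * (T * ε ^ 2)) :=
      hle.trans (mul_le_mul hDle h2 (sq_nonneg _) hDsum)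
    have h4 : (∑ j, D j) * C ^ 2 < 1 := by
      rw [hC, div_pow, one_pow, mul_one_div, div_lt_one (by positivity)]
      nlinarith
    have h5 : 0 < T * ε ^ 2 := by positivity
    nlinarith
  refine ⟨hdecl, fun hne => ?_⟩
  -- If the test never fires before `Tbar`, the declaration found above must come from an empty
  -- auxiliary set.
  by_contra! hcon
  obtain ⟨n, hn, hdec⟩ := hdecl
  exact (hne n fun m hm => hcon m (hm.trans_lt hn)).ne_empty (hdec.resolve_left (hcon n hn))
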